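/- Let $(W,S)$ be a finite Coxeter system with length function $\ell$, and order $W$ by the (right) weak order, $u\le v\iff \ell(u)+\ell(u^{-1}v)=\ell(v)$, which is a lattice. For $I\subseteq S$ let $W_I$ be the standard parabolic subgroup generated by $I$, let $w_{\circ,I}$ be its longest element, and let $W^I=\{x\in W : \ell(xs)>\ell(x)\text{ for all }s\in I\}$. Let $\mathcal P_W=\{xW_I : I\subseteq S,\ x\in W^I\}$ be the Coxeter complex, i.e. the set of all standard parabolic cosets. Let $\equiv$ be a lattice congruence of the weak order on $W$, and write $\pi^\uparrow(x)$ and $\pi_\downarrow(x)$ for the maximal and minimal elements of the $\equiv$-class of $x$. For a coset $xW_I$ with $x\in W^I$: * let $\Sigma^\uparrow(x,I)$ be the set of all $\sigma^\uparrow(x,t)$ for $t\in I$ with $x\not\equiv xt$, where $\sigma^\uparrow(x,t)$ is the unique $\sigma\in S$ that is not a right descent of $\pi^\uparrow(x)$ and satisfies $xt\le\pi^\uparrow(x)\sigma$ and $xt\equiv\pi^\uparrow(x)\sigma$; * let $\Sigma_\downarrow(x,I)$ be the unique set $K$ of right descents (in $S$) of $\pi_\downarrow(xw_{\circ,I})$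 such that $\pi_\downarrow(xw_{\circ,I})w_{\circ,K}\le x$ and $\pi_\downarrow(xw_{\circ,I})w_{\circ,K}\equiv x$. Define $\Pi^\uparrow,\Pi_\downarrow:\mathcal P_W\to\mathcal P_W$ by $\Pi^\uparrow(xW_I)=\pi^\uparrow(x)W_{\Sigma^\uparrow(x,I)}$ and $\Pi_\downarrow(xW_I)=\pi_\downarrow(xw_{\circ,I})W_{\Sigma_\downarrow(x,I)}$ for $x\in W^I$. Then $\Pi^\uparrow$ and $\Pi_\downarrow$ have the same fibers. Let $\cong$ be the equivalence relation on $\mathcal P_W$ whose classes are these common fibers (the facial congruence induced by $\equiv$). For all $I,J\subseteq S$, $x\in W^I$ and $y\in W^J$, $$xW_I\cong yW_J\iff x\equiv y\ \text{ and }\ xw_{\circ,I}\equiv yw_{\circ,J}.$$ In particular, the restriction of $\cong$ to $W$, identified with the set of cosets $xW_\varnothing=\{x\}$, is $\equiv$: for all $x,y\in W$, $x\equiv y\iff xW_\varnothing\cong yW_\varnothing$. -/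

import Mathlib

open scoped Pointwise

namespace CoxeterSystem

section FacialWeakOrder

variable {B W : Type*} [Group W] {M : CoxeterMatrix B} (cs : CoxeterSystem M W)

/-- The (right) weak order: `u ≤ v` iff `ℓ(u) + ℓ(u⁻¹ v) = ℓ(v)`, i.e. `u` is a prefix of `v`. -/
def WeakLE (u v : W) : Prop :=
  cs.length u + cs.length (u⁻¹ * v) = cs.length v

theorem WeakLE.trans {u v w : W} (h₁ : cs.WeakLE u v) (h₂ : cs.WeakLE v w) : cs.WeakLE u w := by
  unfold WeakLE at *
  have h₃ := cs.length_mul_le (u⁻¹ * v) (v⁻¹ * w)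
  have h₄ := cs.length_mul_le u (u⁻¹ * w)
  have e₁ : u⁻¹ * v * (v⁻¹ * w) = u⁻¹ * w := by group
  have e₂ : u * (u⁻¹ * w) = w := by group
  rw [e₁] at h₃
  rw [e₂] at h₄
  omega

theorem WeakLE.antisymm {u v : W} (h₁ : cs.WeakLE u v) (h₂ : cs.WeakLE v u) : u = v := by
  unfold WeakLE at *
  have h : cs.length (u⁻¹ * v) = 0 := by omega
  rw [cs.length_eq_zero_iff] at h
  exact inv_mul_eq_one.mp h

/-- The right weak order as a partial order on `W` (not declared as an instance). -/
abbrev weakOrder : PartialOrder W where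
  le := cs.WeakLE
  le_refl u := by simp [WeakLE]
  le_trans _ _ _ := WeakLE.trans cs
  le_antisymm _ _ := WeakLE.antisymm cs

/-- Lattice congruences of the weak order: equivalence relations compatible with binary meets
and binary joins. Meets and joins are those of the weak order, described as greatest lower and
least upper bounds of pairs. -/
structure IsWeakOrderCongruence (r : Setoid W) : Prop where
  meet : ∀ ⦃x x' y y' m m' : W⦄, r x x' → r y y' →
    @IsGLB W cs.weakOrder.toLE {x, y} m → @IsGLB W cs.weakOrder.toLE {x', y'} m' → r m m'
  join : ∀ ⦃x x' y y' j j' : W⦄, r x x' → r y y' →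
    @IsLUB W cs.weakOrder.toLE {x, y} j → @IsLUB W cs.weakOrder.toLE {x', y'} j' → r j j'

/-- `π↑(x)`: the maximal element, in weak order, of the class of `x`. -/
noncomputable def projUp (r : Setoid W) (x : W) : W :=
  Classical.epsilon fun m => @IsGreatest W cs.weakOrder.toLE {y | r x y} m

/-- `π↓(x)`: the minimal element, in weak order, of the class of `x`. -/
noncomputable def projDown (r : Setoid W) (x : W) : W :=
  Classical.epsilon fun m => @IsLeast W cs.weakOrder.toLE {y | r x y} m

/-- `x ≤ y` in weak order and `x ≡ y`. -/
def WeakLECong (r : Setoid W) (x y : W) : Prop :=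
  cs.WeakLE x y ∧ r x y

/-- The standard parabolic subgroup `W_I`. -/
def parabolic (I : Set B) : Subgroup W :=
  Subgroup.closure (cs.simple '' I)

/-- The set `W^I` of elements with no right descent in `I`. -/
def minReps (I : Set B) : Set W :=
  {x | ∀ i ∈ I, cs.length x < cs.length (x * cs.simple i)}

/-- The longest element `w_{∘,I}` of `W_I` (which exists and is unique when `W` is finite). -/
noncomputable def longest (I : Set B) : W :=
  Classical.epsilon fun w => w ∈ cs.parabolic I ∧ ∀ v ∈ cs.parabolic I, cs.length v ≤ cs.length w

/-- The Coxeter complex: the set of all standard parabolic cosets `x W_I`, as subsets of `W`. -/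
def coxeterComplex : Set (Set W) :=
  {F | ∃ (x : W) (I : Set B), F = x • (cs.parabolic I : Set W)}

/-- The coset `x W_I` as an element of the Coxeter complex. -/
def coset (x : W) (I : Set B) : cs.coxeterComplex :=
  ⟨x • (cs.parabolic I : Set W), x, I, rfl⟩

theorem exists_minRep (F : cs.coxeterComplex) :
    ∃ p : W × Set B, p.1 ∈ cs.minReps p.2 ∧ F = cs.coset p.1 p.2 := by
  obtain ⟨F, x, I, rfl⟩ := F
  obtain ⟨w, hw, hmin⟩ := WellFounded.has_min (measure cs.length).wf
    (x • (cs.parabolic I : Set W)) ⟨x, 1, (cs.parabolic I).one_mem, by simp⟩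
  have hxw : x⁻¹ * w ∈ cs.parabolic I := by
    simpa [Set.mem_smul_set_iff_inv_smul_mem] using hw
  refine ⟨(w, I), fun i hi => ?_, Subtype.ext ?_⟩
  · have hs : cs.simple i ∈ cs.parabolic I := Subgroup.subset_closure ⟨i, hi, rfl⟩
    have hmem : w * cs.simple i ∈ x • (cs.parabolic I : Set W) := by
      rw [Set.mem_smul_set_iff_inv_smul_mem, smul_eq_mul, ← mul_assoc]
      exact (cs.parabolic I).mul_mem hxw hs
    have h₁ : ¬ cs.length (w * cs.simple i) < cs.length w := hmin _ hmem
    exact lt_of_le_of_ne (not_lt.mp h₁) (cs.length_mul_simple_ne w i).symm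
  · change x • (cs.parabolic I : Set W) = w • (cs.parabolic I : Set W)
    exact (leftCoset_eq_iff (cs.parabolic I)).mpr hxw

/-- The minimal length representative `x ∈ W^I` of a standard parabolic coset `F = x W_I`. -/
noncomputable def rep (F : cs.coxeterComplex) : W :=
  (cs.exists_minRep F).choose.1

/-- The set `I ⊆ S` of a standard parabolic coset `F = x W_I` with `x ∈ W^I`. -/
noncomputable def type (F : cs.coxeterComplex) : Set B :=
  (cs.exists_minRep F).choose.2

/-- `Σ↑(x, I)`: the set of the `σ↑(x, t)` with `t ∈ I` and `x ≢ xt`, where `σ↑(x, t)` is the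
element `σ` of `S`, not a right descent of `π↑(x)`, such that `xt ≤ π↑(x)σ` and `xt ≡ π↑(x)σ`. -/
def sigmaUp (r : Setoid W) (x : W) (I : Set B) : Set B :=
  {σ | ∃ t ∈ I, ¬ r x (x * cs.simple t) ∧ ¬ cs.IsRightDescent (cs.projUp r x) σ ∧
    cs.WeakLECong r (x * cs.simple t) (cs.projUp r x * cs.simple σ)}

/-- `Σ↓(x, I)`: the unique subset `K` of the right descents of `π↓(x w_{∘,I})` such that
`π↓(x w_{∘,I}) w_{∘,K} ≤ x` and `π↓(x w_{∘,I}) w_{∘,K} ≡ x`. -/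
noncomputable def sigmaDown (r : Setoid W) (x : W) (I : Set B) : Set B :=
  Classical.epsilon fun K : Set B =>
    (∀ σ ∈ K, cs.IsRightDescent (cs.projDown r (x * cs.longest I)) σ) ∧
      cs.WeakLECong r (cs.projDown r (x * cs.longest I) * cs.longest K) x

/-- `Π↑(x W_I) = π↑(x) W_{Σ↑(x, I)}`, where `x ∈ W^I`. -/
noncomputable def facialProjUp (r : Setoid W) (F : cs.coxeterComplex) : cs.coxeterComplex :=
  cs.coset (cs.projUp r (cs.rep F)) (cs.sigmaUp r (cs.rep F) (cs.type F))

/-- `Π↓(x W_I) = π↓(x w_{∘,I}) W_{Σ↓(x, I)}`, where `x ∈ W^I`. -/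
noncomputable def facialProjDown (r : Setoid W) (F : cs.coxeterComplex) : cs.coxeterComplex :=
  cs.coset (cs.projDown r (cs.rep F * cs.longest (cs.type F)))
    (cs.sigmaDown r (cs.rep F) (cs.type F))

/-- The facial congruence induced by `r`: its classes are the fibers of `Π↑` (which coincide
with the fibers of `Π↓` when `r` is a lattice congruence of the weak order). -/
noncomputable def facialCongruence (r : Setoid W) : Setoid cs.coxeterComplex :=
  Setoid.ker (cs.facialProjUp r)

end FacialWeakOrder

end CoxeterSystem

/-! A class of the facial congruence should record exactly the classes of the bottom `x` and the top
`x w_I` of a coset. Put `z = π↑(x)` and `K = Σ↑(x, I)`. For `x ∈ W^I`, the top is the join of `x`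
and the atoms `x s`, `s ∈ I`. Hence `x w_I ≤ z w_K ≤ π↑(x w_I)`, and convexity of classes gives `z
w_K ≡ x w_I` (`weakLECong_mul_longest_sigmaUp`). So `z W_K` determines both classes.

Conversely, the class of `x` determines `z`, and the class of `z w_K` determines `K`. If `z w_K ≡ z
w_{K'}` and `k ∈ K`, then `z s_k ∧ z w_{K'}` is congruent to `z s_k` and lies between `z` and `z
s_k`. It is not `z`, the maximum of its class, so `z s_k ≤ z w_{K'}` and `s_k` is among the
generators of `W_{K'}` (`image_subset_of_rel`).

Left multiplication by the longest element reverses the weak order and carries congruences to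
congruences, exchanging tops and bottoms of cosets. This gives the same criterion for `Π↓`, so the
two maps have the same fibers. The Coxeter theory underneath (additivity of lengths, existence of
joins) rests on strong exchange. -/

namespace CoxeterSystem

/-! ### Strong exchange via the signed conjugation action. -/

section Exchange

variable {B W : Type*} [Group W] {M : CoxeterMatrix B} (cs : CoxeterSystem M W)

open Classical in
/-- The generators of the action of `W` on `W × ZMod 2` that conjugates the first component and
records in the second one whether a reflection becomes an inversion. -/
noncomputable def signedConj (i : B) : Function.End (W × ZMod 2) :=
  fun p => (cs.simple i * p.1 * cs.simple i, p.2 + if p.1 = cs.simple i then 1 else 0)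

theorem simple_mul_dihedral_pow (i j : B) (k : ℕ) :
    ((cs.simple i * cs.simple j)⁻¹) ^ k * cs.simple j =
      cs.simple j * (cs.simple i * cs.simple j) ^ k := by
  induction k with
  | zero => simp
  | succ k ih =>
    rw [pow_succ', mul_assoc, ih, pow_succ']
    simp [mul_assoc]

-- The sum runs over the right inversion sequence of the alternating word of length `2k`, whose
-- terms, read from the right end of the word, are `c⁻ⁿ s_j` with `c = s_i s_j`.
open Classical in
theorem signedConj_mul_pow (i j : B) (k : ℕ) (t : W) (ε : ZMod 2) :
    ((cs.signedConj i * cs.signedConj j) ^ k) (t, ε) =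
      ((cs.simple i * cs.simple j) ^ k * t * ((cs.simple i * cs.simple j) ^ k)⁻¹,
        ε + ∑ n ∈ Finset.range (2 * k),
          if t = ((cs.simple i * cs.simple j)⁻¹) ^ n * cs.simple j then 1 else 0) := by
  induction k with
  | zero => simp; rfl
  | succ k ih =>
    have hc : ∀ n, ((cs.simple i * cs.simple j)⁻¹) ^ n * cs.simple j =
      cs.simple j * (cs.simple i * cs.simple j) ^ n := cs.simple_mul_dihedral_pow i j
    set c := cs.simple i * cs.simple j with hcd
    -- Round `k + 1` applies `s_j`, then `s_i`; `e1` and `e2` identify their sign flips with the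
    -- terms `n = 2k` and `n = 2k + 1`.
    have e1 : (c ^ k * t * (c ^ k)⁻¹ = cs.simple j) ↔ t = c⁻¹ ^ (2 * k) * cs.simple j := by
      have h2 : c⁻¹ ^ (2 * k) * cs.simple j = (c ^ k)⁻¹ * cs.simple j * c ^ k := by
        rw [two_mul, pow_add, mul_assoc (c⁻¹ ^ k), hc, ← inv_pow, mul_assoc]
      rw [h2]
      constructor
      · intro h
        rw [← h]
        simp [mul_assoc]
      · rintro rfl
        simp [mul_assoc]
    have e2 : (cs.simple j * (c ^ k * t * (c ^ k)⁻¹) * cs.simple j = cs.simple i) ↔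
        t = c⁻¹ ^ (2 * k + 1) * cs.simple j := by
      have h1 : c⁻¹ * cs.simple j = cs.simple j * cs.simple i * cs.simple j := by
        simp [hcd]
      have h2 : c⁻¹ ^ (2 * k + 1) * cs.simple j =
          (c ^ k)⁻¹ * (cs.simple j * cs.simple i * cs.simple j) * c ^ k := by
        rw [← h1, show 2 * k + 1 = k + 1 + k by ring, pow_add, mul_assoc, hc, pow_succ, ← inv_pow]
        simp only [mul_assoc]
      rw [h2]
      constructor
      · intro h
        rw [← h]
        simp [mul_assoc]
      · rintro rfl
        simp [mul_assoc]
    have step : ((cs.signedConj i * cs.signedConj j) ^ (k + 1)) (t, ε) =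
        cs.signedConj i (cs.signedConj j (((cs.signedConj i * cs.signedConj j) ^ k) (t, ε))) := by
      rw [pow_succ']; rfl
    rw [step, ih, show 2 * (k + 1) = 2 * k + 1 + 1 by ring, Finset.sum_range_succ,
      Finset.sum_range_succ]
    simp only [signedConj, e1, e2]
    refine Prod.ext ?_ ?_
    · simp [pow_succ', hcd, mul_assoc]
    · simp [add_assoc]

/-- Since `c ^ M i j = 1`, the terms `n` and `n + M i j` agree, so every contribution occurs twice
and vanishes mod 2. -/
theorem isLiftable_signedConj : M.IsLiftable cs.signedConj := by
  classical
  intro i j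
  funext ⟨t, ε⟩
  rw [signedConj_mul_pow]
  have hm : (cs.simple i * cs.simple j) ^ M i j = 1 := cs.simple_mul_simple_pow i j
  have hs : ∑ n ∈ Finset.range (2 * M i j),
      (if t = ((cs.simple i * cs.simple j)⁻¹) ^ n * cs.simple j then (1 : ZMod 2) else 0) = 0 := by
    rw [two_mul, Finset.sum_range_add]
    simp only [pow_add, inv_pow, hm, inv_one, one_mul]
    exact CharTwo.add_self_eq_zero _
  rw [hs, hm]
  simp
  rfl

/-- The action of `W` on `W × ZMod 2` extending `signedConj`. -/
noncomputable def signedConjHom : W →* Function.End (W × ZMod 2) :=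
  cs.lift ⟨cs.signedConj, cs.isLiftable_signedConj⟩

/-- The inversion cocycle: on a reflection `t` it is `1` iff `t` is a right inversion of `w`. -/
noncomputable def inversionSign (w t : W) : ZMod 2 := (cs.signedConjHom w (t, 0)).2

open Classical in
theorem signedConjHom_wordProd (ω : List B) (t : W) (ε : ZMod 2) :
    cs.signedConjHom (cs.wordProd ω) (t, ε) =
      (cs.wordProd ω * t * (cs.wordProd ω)⁻¹, ε + ((cs.rightInvSeq ω).count t : ZMod 2)) := by
  induction ω with
  | nil => simp; rfl
  | cons i ω ih =>
    have h : cs.signedConjHom (cs.wordProd (i :: ω)) (t, ε) =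
        cs.signedConj i (cs.signedConjHom (cs.wordProd ω) (t, ε)) := by
      rw [wordProd_cons, map_mul, signedConjHom, lift_apply_simple]; rfl
    rw [h, ih]
    simp only [signedConj, rightInvSeq, List.count_cons, wordProd_cons]
    have e : (cs.wordProd ω * t * (cs.wordProd ω)⁻¹ = cs.simple i) ↔
        (cs.wordProd ω)⁻¹ * cs.simple i * cs.wordProd ω = t := by
      constructor
      · intro h; rw [← h]; group
      · intro h; rw [← h]; group
    refine Prod.ext ?_ ?_
    · simp [mul_assoc]
    · simp only [e, beq_iff_eq]
      split_ifs <;> simp [add_assoc]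

-- The left side depends only on the group element, so the parity of the multiplicity of `t` is
-- independent of the word.
open Classical in
theorem inversionSign_wordProd (ω : List B) (t : W) :
    cs.inversionSign (cs.wordProd ω) t = ((cs.rightInvSeq ω).count t : ZMod 2) := by
  simp [inversionSign, signedConjHom_wordProd]

theorem signedConjHom_apply (w t : W) (ε : ZMod 2) :
    cs.signedConjHom w (t, ε) = (w * t * w⁻¹, ε + cs.inversionSign w t) := by
  classical
  obtain ⟨ω, rfl⟩ := cs.wordProd_surjective w
  rw [inversionSign_wordProd, signedConjHom_wordProd]

theorem inversionSign_mul (u v t : W) :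
    cs.inversionSign (u * v) t = cs.inversionSign v t + cs.inversionSign u (v * t * v⁻¹) := by
  have h : cs.signedConjHom (u * v) (t, 0) = cs.signedConjHom u (cs.signedConjHom v (t, 0)) := by
    rw [map_mul]; rfl
  rw [inversionSign, h, signedConjHom_apply, signedConjHom_apply]
  simp

theorem inversionSign_one (t : W) : cs.inversionSign 1 t = 0 := by
  simp [inversionSign]
  rfl

theorem inversionSign_self {t : W} (ht : cs.IsReflection t) : cs.inversionSign t t = 1 := by
  classical
  obtain ⟨w, i, rfl⟩ := ht
  have h₁ := cs.inversionSign_mul w w⁻¹ (w * cs.simple i * w⁻¹)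
  have h₂ : cs.inversionSign (cs.simple i) (cs.simple i) = 1 := by
    have := cs.inversionSign_wordProd [i] (cs.simple i)
    simpa using this
  rw [mul_inv_cancel, inversionSign_one] at h₁
  rw [mul_assoc w, inversionSign_mul, inversionSign_mul, ← mul_assoc w]
  have e : w⁻¹ * (w * cs.simple i * w⁻¹) * w⁻¹⁻¹ = cs.simple i := by group
  have e' : cs.simple i * w⁻¹ * (w * cs.simple i * w⁻¹) * (cs.simple i * w⁻¹)⁻¹ = cs.simple i := by
    simp [mul_assoc]
  rw [e] at h₁ ⊢
  rw [e', h₂, add_right_comm, ← h₁, zero_add]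

theorem exists_rightInvSeq_of_inversionSign {ω : List B} {t : W}
    (h : cs.inversionSign (cs.wordProd ω) t ≠ 0) : t ∈ cs.rightInvSeq ω := by
  classical
  rw [inversionSign_wordProd] at h
  by_contra hn
  exact h (by rw [List.count_eq_zero_of_not_mem hn]; rfl)

/-- A nonzero sign puts `t` in the inversion sequence of a reduced word. If the sign of `w` at `t`
were zero, the cocycle rule would make that of `w * t` nonzero, so `t` would be an inversion of `w *
t` and not of `w`. -/
theorem isRightInversion_iff_inversionSign {w t : W} (ht : cs.IsReflection t) :
    cs.IsRightInversion w t ↔ cs.inversionSign w t ≠ 0 := by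
  have key : ∀ v, cs.inversionSign v t ≠ 0 → cs.IsRightInversion v t := by
    intro v hv
    obtain ⟨ω, hω, rfl⟩ := cs.exists_isReduced v
    exact cs.isRightInversion_of_mem_rightInvSeq hω (cs.exists_rightInvSeq_of_inversionSign hv)
  refine ⟨fun h h₀ => ?_, key w⟩
  have h₁ : cs.inversionSign (w * t) t ≠ 0 := by
    rw [inversionSign_mul, cs.inversionSign_self ht, mul_inv_cancel_right, h₀]
    simp
  exact (ht.isRightInversion_mul_left_iff.mp (key _ h₁)) h

/-- The strong exchange property. -/
theorem mem_rightInvSeq_of_isRightInversion {ω : List B} {t : W}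
    (h : cs.IsRightInversion (cs.wordProd ω) t) : t ∈ cs.rightInvSeq ω :=
  cs.exists_rightInvSeq_of_inversionSign ((cs.isRightInversion_iff_inversionSign h.1).mp h)

/-- The strong exchange property, on the left. -/
theorem mem_leftInvSeq_of_isLeftInversion {ω : List B} {t : W}
    (h : cs.IsLeftInversion (cs.wordProd ω) t) : t ∈ cs.leftInvSeq ω := by
  rw [← isRightInversion_inv_iff, ← wordProd_reverse] at h
  have := cs.mem_rightInvSeq_of_isRightInversion h
  rwa [rightInvSeq_reverse, List.mem_reverse] at this

theorem exists_eraseIdx_of_isLeftInversion {ω : List B} {t : W}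
    (h : cs.IsLeftInversion (cs.wordProd ω) t) :
    ∃ j < ω.length, t * cs.wordProd ω = cs.wordProd (ω.eraseIdx j) := by
  obtain ⟨j, hj, rfl⟩ := List.mem_iff_getElem.mp (cs.mem_leftInvSeq_of_isLeftInversion h)
  refine ⟨j, by simpa using hj, ?_⟩
  rw [← List.getD_eq_getElem _ 1 hj, getD_leftInvSeq_mul_wordProd]

/-- A left inversion of `u * c` is a left inversion of `u` or comes from one of `c`. -/
theorem IsLeftInversion.of_mul {u c t : W} (h : cs.IsLeftInversion (u * c) t) :
    cs.IsLeftInversion u t ∨ cs.IsLeftInversion c (u⁻¹ * t * u) := by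
  have ht := h.1
  have ht' : cs.IsReflection (u⁻¹ * t * u) := by simpa using ht.conj u⁻¹
  rw [← isRightInversion_inv_iff, cs.isRightInversion_iff_inversionSign ht, mul_inv_rev,
    inversionSign_mul, inv_inv] at h
  rw [← isRightInversion_inv_iff, ← isRightInversion_inv_iff,
    cs.isRightInversion_iff_inversionSign ht, cs.isRightInversion_iff_inversionSign ht']
  by_contra hn
  push Not at hn
  exact h (by rw [hn.1, hn.2, add_zero])

end Exchange

/-! ### Parabolic subgroups, minimal representatives and covers in the weak order. -/

section Parabolic

variable {B W : Type*} [Group W] {M : CoxeterMatrix B} (cs : CoxeterSystem M W)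

theorem simple_mem_parabolic {I : Set B} {i : B} (hi : i ∈ I) : cs.simple i ∈ cs.parabolic I :=
  Subgroup.subset_closure ⟨i, hi, rfl⟩

theorem wordProd_mem_parabolic {I : Set B} {ω : List B} (h : ∀ i ∈ ω, i ∈ I) :
    cs.wordProd ω ∈ cs.parabolic I := by
  induction ω with
  | nil => simp
  | cons i ω ih =>
    rw [wordProd_cons]
    exact mul_mem (cs.simple_mem_parabolic (h i (by simp))) (ih fun j hj => h j (by simp [hj]))

@[elab_as_elim]
theorem parabolic_induction_left {I : Set B} {p : (a : W) → a ∈ cs.parabolic I → Prop}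
    (one : p 1 (one_mem _))
    (mul : ∀ (i : B) (hi : i ∈ I) (a : W) (ha : a ∈ cs.parabolic I), p a ha →
      p (cs.simple i * a) (mul_mem (cs.simple_mem_parabolic hi) ha)) {a : W}
    (ha : a ∈ cs.parabolic I) : p a ha := by
  induction ha using Subgroup.closure_induction_left with
  | one => exact one
  | mul_left x hx y hy ih => obtain ⟨i, hi, rfl⟩ := hx; exact mul i hi y hy ih
  | inv_mul_cancel x hx y hy ih =>
    obtain ⟨i, hi, rfl⟩ := hx
    have h := mul i hi y hy ih
    simpa only [inv_simple] using h

theorem mem_parabolic_univ (w : W) : w ∈ cs.parabolic Set.univ := by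
  simp [parabolic, subgroup_closure_range_simple]

/-- Elements of `W_I` have reduced words in `I`. -/
theorem exists_isReduced_of_mem_parabolic {I : Set B} {a : W} (ha : a ∈ cs.parabolic I) :
    ∃ ω : List B, cs.IsReduced ω ∧ (∀ i ∈ ω, i ∈ I) ∧ cs.wordProd ω = a := by
  induction ha using cs.parabolic_induction_left with
  | one => exact ⟨[], by simp [IsReduced], by simp, by simp⟩
  | mul i hi a ha ih =>
    obtain ⟨ω, hω, hI, rfl⟩ := ih
    by_cases hd : cs.IsLeftDescent (cs.wordProd ω) i
    · obtain ⟨j, hj, e⟩ := cs.exists_eraseIdx_of_isLeftInversion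
        ((cs.isLeftInversion_simple_iff_isLeftDescent _ i).mpr hd)
      refine ⟨ω.eraseIdx j, ?_, fun k hk => hI k (List.mem_of_mem_eraseIdx hk), e.symm⟩
      have h₁ := cs.isLeftDescent_iff.mp hd
      have h₂ := List.length_eraseIdx_add_one hj
      rw [e, hω.eq] at h₁
      unfold IsReduced
      omega
    · refine ⟨i :: ω, ?_, ?_, cs.wordProd_cons i ω⟩
      · rw [IsReduced, wordProd_cons, cs.not_isLeftDescent_iff.mp hd, hω.eq, List.length_cons]
      · simpa [hi] using hI

/-- Sets of generators are compared through their images in `W`, so injectivity of `simple` is never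
needed. -/
theorem simple_mem_parabolic_iff {I : Set B} {i : B} :
    cs.simple i ∈ cs.parabolic I ↔ cs.simple i ∈ cs.simple '' I := by
  refine ⟨fun h => ?_, fun h => Subgroup.subset_closure h⟩
  obtain ⟨ω, hω, hI, e⟩ := cs.exists_isReduced_of_mem_parabolic h
  have hl : ω.length = 1 := by rw [← hω.eq, e, length_simple]
  obtain ⟨j, rfl⟩ := List.length_eq_one_iff.mp hl
  exact ⟨j, hI j (by simp), by simpa using e⟩

theorem exists_leftDescent_of_mem_parabolic {I : Set B} {a : W} (ha : a ∈ cs.parabolic I)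
    (h : a ≠ 1) : ∃ i ∈ I, cs.IsLeftDescent a i := by
  obtain ⟨ω, hω, hI, rfl⟩ := cs.exists_isReduced_of_mem_parabolic ha
  match ω with
  | [] => simp at h
  | i :: ω =>
    refine ⟨i, hI i (by simp), ?_⟩
    have := cs.length_wordProd_le ω
    rw [IsLeftDescent, hω.eq, wordProd_cons, simple_mul_simple_cancel_left, List.length_cons]
    omega

/-- Left descents of an element of `W_I` lie in `W_I`. -/
theorem simple_mem_image_of_isLeftDescent {I : Set B} {a : W} {i : B} (ha : a ∈ cs.parabolic I)
    (h : cs.IsLeftDescent a i) : cs.simple i ∈ cs.simple '' I := by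
  obtain ⟨ω, hω, hI, rfl⟩ := cs.exists_isReduced_of_mem_parabolic ha
  obtain ⟨j, hj, e⟩ := cs.exists_eraseIdx_of_isLeftInversion
    ((cs.isLeftInversion_simple_iff_isLeftDescent _ i).mpr h)
  rw [← simple_mem_parabolic_iff, ← (cs.parabolic I).mul_mem_cancel_right ha, e]
  exact cs.wordProd_mem_parabolic fun k hk => hI k (List.mem_of_mem_eraseIdx hk)

/-- A left descent `s` of `a * b` that is not one of `a` would make `a⁻¹ s a ∈ W_I` an inversion of
`b`, contradicting minimality of `b`. -/
theorem length_mul_of_forall_le {I : Set B} {a b : W} (ha : a ∈ cs.parabolic I)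
    (hb : ∀ c ∈ cs.parabolic I, cs.length b ≤ cs.length (c * b)) :
    cs.length (a * b) = cs.length a + cs.length b := by
  induction ha using cs.parabolic_induction_left with
  | one => simp
  | mul i hi a ha ih =>
    have h₁ := cs.length_simple_mul (a * b) i
    have h₂ := cs.length_simple_mul a i
    have h₃ := cs.length_mul_le (cs.simple i * a) b
    rw [← mul_assoc] at h₁
    by_cases hd : cs.IsLeftDescent (a * b) i
    · rcases ((cs.isLeftInversion_simple_iff_isLeftDescent _ i).mpr hd).of_mul with h | h
      · have := h.2
        have := cs.isLeftDescent_iff.mp hd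
        rw [← mul_assoc] at this
        omega
      · have h₄ := hb _ (mul_mem (mul_mem (inv_mem ha) (cs.simple_mem_parabolic hi)) ha)
        exact absurd h.2 (not_lt.mpr h₄)
    · have := cs.not_isLeftDescent_iff.mp hd
      rw [← mul_assoc] at this
      omega

/-- Length is additive on the decomposition `x * a` with `x ∈ W^I` and `a ∈ W_I`. -/
theorem length_mul_of_mem_minReps {I : Set B} {x a : W} (hx : x ∈ cs.minReps I)
    (ha : a ∈ cs.parabolic I) : cs.length (x * a) = cs.length x + cs.length a := by
  -- Lengths add over a shortest element `c * x⁻¹` of `W_I x⁻¹`. A left descent of `c⁻¹` would then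
  -- be one of `x⁻¹`, contradicting `x ∈ W^I`; hence `c = 1`.
  obtain ⟨b, hb, hmin⟩ := WellFounded.has_min (measure cs.length).wf
    {b | ∃ c ∈ cs.parabolic I, b = c * x⁻¹} ⟨x⁻¹, 1, one_mem _, by simp⟩
  obtain ⟨c, hc, rfl⟩ := hb
  have hmin' : ∀ d ∈ cs.parabolic I, cs.length (c * x⁻¹) ≤ cs.length (d * (c * x⁻¹)) :=
    fun d hd => not_lt.mp (hmin _ ⟨d * c, mul_mem hd hc, by rw [mul_assoc]⟩)
  have hadd := fun a ha => cs.length_mul_of_forall_le (a := a) ha hmin'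
  have hc1 : c⁻¹ = 1 := by
    by_contra hne
    obtain ⟨i, hi, hd⟩ := cs.exists_leftDescent_of_mem_parabolic (inv_mem hc) hne
    have h₁ := hadd _ (inv_mem hc)
    have h₂ := hadd _ (mul_mem (cs.simple_mem_parabolic hi) (inv_mem hc))
    have h₃ := hx i hi
    rw [← cs.length_inv x, ← cs.length_inv (x * _), mul_inv_rev, inv_simple] at h₃
    have e₁ : c⁻¹ * (c * x⁻¹) = x⁻¹ := by group
    have e₂ : cs.simple i * c⁻¹ * (c * x⁻¹) = cs.simple i * x⁻¹ := by group
    rw [e₁] at h₁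
    rw [e₂] at h₂
    unfold IsLeftDescent at hd
    omega
  have hc1' : c = 1 := by simpa using hc1
  have := hadd _ (inv_mem ha)
  rw [hc1', one_mul, ← mul_inv_rev] at this
  rwa [length_inv, length_inv, length_inv, add_comm] at this

theorem weakLE_of_length_le {u v : W}
    (h : cs.length u + cs.length (u⁻¹ * v) ≤ cs.length v) : cs.WeakLE u v := by
  have := cs.length_mul_le u (u⁻¹ * v)
  rw [mul_inv_cancel_left] at this
  exact le_antisymm h this

theorem weakLE_refl (u : W) : cs.WeakLE u u := by simp [WeakLE]

/-- If every element of `I` is a left descent of `a`, then `a` is above `W_I`. -/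
theorem weakLE_of_forall_isLeftDescent {I : Set B} {a u : W}
    (ha : ∀ i ∈ I, cs.IsLeftDescent a i) (hu : u ∈ cs.parabolic I) : cs.WeakLE u a := by
  obtain ⟨ω, hω, hI, rfl⟩ := cs.exists_isReduced_of_mem_parabolic hu
  clear hu
  induction ω with
  | nil => simp [WeakLE]
  | cons i ω ih =>
    have hω' : cs.IsReduced ω := by simpa using hω.drop 1
    have hle := ih hω' fun j hj => hI j (by simp [hj])
    have hd := ha i (hI i (by simp))
    have e : a = cs.wordProd ω * ((cs.wordProd ω)⁻¹ * a) := by group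
    rw [e, ← isLeftInversion_simple_iff_isLeftDescent] at hd
    -- With `u` the product of `ω`, either `s_i` shortens `u`, contradicting reducedness of `i ::
    -- ω`, or `u⁻¹ s_i u` shortens `u⁻¹ a`, which gives `s_i u ≤ a`.
    rcases hd.of_mul with h | h
    · have h₁ := h.2
      rw [← wordProd_cons, hω.eq, hω'.eq, List.length_cons] at h₁
      omega
    · have h₁ := h.2
      apply cs.weakLE_of_length_le
      unfold WeakLE at hle
      have e' : (cs.wordProd (i :: ω))⁻¹ * a =
          (cs.wordProd ω)⁻¹ * cs.simple i * cs.wordProd ω * ((cs.wordProd ω)⁻¹ * a) := by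
        rw [wordProd_cons, mul_inv_rev, inv_simple]
        group
      rw [e', hω.eq, List.length_cons]
      rw [hω'.eq] at hle
      omega

theorem weakLE_mul_simple {x : W} {i : B} (h : cs.length x < cs.length (x * cs.simple i)) :
    cs.WeakLE x (x * cs.simple i) := by
  have := cs.length_mul_simple x i
  rw [WeakLE, inv_mul_cancel_left, length_simple]
  omega

/-- If `x` is below both `x * s` and `v`, then `x * s` is below `v` iff `s` is a left descent of
`x⁻¹ * v`. -/
theorem mul_simple_weakLE_iff {x v : W} {i : B} (hx : cs.length x < cs.length (x * cs.simple i))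
    (hv : cs.WeakLE x v) :
    cs.WeakLE (x * cs.simple i) v ↔ cs.IsLeftDescent (x⁻¹ * v) i := by
  have := cs.length_mul_simple x i
  unfold WeakLE at *
  rw [isLeftDescent_iff, mul_inv_rev, inv_simple, mul_assoc]
  omega

theorem eq_or_eq_of_weakLE_mul_simple {x y : W} {i : B}
    (hx : cs.length x < cs.length (x * cs.simple i)) (h₁ : cs.WeakLE x y)
    (h₂ : cs.WeakLE y (x * cs.simple i)) : y = x ∨ y = x * cs.simple i := by
  have := cs.length_mul_simple x i
  unfold WeakLE at *
  rcases (show cs.length (x⁻¹ * y) = 0 ∨ cs.length (y⁻¹ * (x * cs.simple i)) = 0 by omega)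
    with h | h
  · left
    rw [length_eq_zero_iff, inv_mul_eq_one] at h
    exact h.symm
  · right
    rwa [length_eq_zero_iff, inv_mul_eq_one] at h

theorem exists_mul_simple_weakLE {x v : W} (h : cs.WeakLE x v) (hne : x ≠ v) :
    ∃ i, cs.length x < cs.length (x * cs.simple i) ∧ cs.WeakLE (x * cs.simple i) v := by
  obtain ⟨i, hi⟩ := cs.exists_leftDescent_of_ne_one (w := x⁻¹ * v) (by
    rw [Ne, inv_mul_eq_one]; exact hne)
  have hd := cs.isLeftDescent_iff.mp hi
  have hlt : cs.length x < cs.length (x * cs.simple i) := by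
    by_contra hn
    have h₁ := cs.length_mul_simple x i
    have h₂ := cs.length_mul_le (x * cs.simple i) (cs.simple i * (x⁻¹ * v))
    have e : x * cs.simple i * (cs.simple i * (x⁻¹ * v)) = v := by simp [mul_assoc]
    rw [e] at h₂
    unfold WeakLE at h
    omega
  exact ⟨i, hlt, (cs.mul_simple_weakLE_iff hlt h).mpr hi⟩

/-- Additivity of length, applied from `x` to `y` and from `y` to `x`, forces `ℓ(x⁻¹ y) = 0`. -/
theorem eq_and_parabolic_eq_of_coset_eq {I J : Set B} {x y : W} (hx : x ∈ cs.minReps I)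
    (hy : y ∈ cs.minReps J) (h : cs.coset x I = cs.coset y J) :
    x = y ∧ cs.parabolic I = cs.parabolic J := by
  have h' : x • (cs.parabolic I : Set W) = y • (cs.parabolic J : Set W) := congrArg Subtype.val h
  have h₁ : x⁻¹ * y ∈ cs.parabolic I := by
    have : y ∈ x • (cs.parabolic I : Set W) := by
      rw [h']; exact ⟨1, one_mem _, by simp⟩
    simpa [Set.mem_smul_set_iff_inv_smul_mem] using this
  have h₂ : y⁻¹ * x ∈ cs.parabolic J := by
    have : x ∈ y • (cs.parabolic J : Set W) := by
      rw [← h']; exact ⟨1, one_mem _, by simp⟩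
    simpa [Set.mem_smul_set_iff_inv_smul_mem] using this
  have e₁ := cs.length_mul_of_mem_minReps hx h₁
  have e₂ := cs.length_mul_of_mem_minReps hy h₂
  rw [mul_inv_cancel_left] at e₁ e₂
  have e₃ : cs.length (x⁻¹ * y) = 0 := by omega
  rw [length_eq_zero_iff, inv_mul_eq_one] at e₃
  subst e₃
  exact ⟨rfl, SetLike.coe_injective (smul_left_cancel x h')⟩

theorem coset_eq_of_parabolic_eq {I J : Set B} (x : W) (h : cs.parabolic I = cs.parabolic J) :
    cs.coset x I = cs.coset x J := by
  apply Subtype.ext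
  simp only [coset, h]

theorem coset_mul_eq {I : Set B} (x : W) {a : W} (ha : a ∈ cs.parabolic I) :
    cs.coset (x * a) I = cs.coset x I := by
  apply Subtype.ext
  simp only [coset]
  exact (leftCoset_eq_iff (cs.parabolic I)).mpr (by simpa using ha)

theorem longest_eq_of_parabolic_eq {I J : Set B} (h : cs.parabolic I = cs.parabolic J) :
    cs.longest I = cs.longest J := by
  simp only [longest, h]

theorem parabolic_eq_of_image_eq {I J : Set B} (h : cs.simple '' I = cs.simple '' J) :
    cs.parabolic I = cs.parabolic J := by
  simp only [parabolic, h]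

theorem rep_mem_minReps (F : cs.coxeterComplex) :
    cs.rep F ∈ cs.minReps (cs.type F) :=
  (cs.exists_minRep F).choose_spec.1

theorem eq_coset_rep (F : cs.coxeterComplex) :
    F = cs.coset (cs.rep F) (cs.type F) :=
  (cs.exists_minRep F).choose_spec.2

theorem projUp_mem_minReps_sigmaUp (r : Setoid W) (x : W) (I : Set B) :
    cs.projUp r x ∈ cs.minReps (cs.sigmaUp r x I) := by
  rintro k ⟨t, -, -, hk, -⟩
  rw [not_isRightDescent_iff] at hk
  omega

/-- The chosen type is compared with `I` only through `longest`, which depends on `W_I` alone;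
nothing more enters the final criterion. -/
theorem rep_coset {x : W} {I : Set B} (hx : x ∈ cs.minReps I) :
    cs.rep (cs.coset x I) = x ∧ cs.longest (cs.type (cs.coset x I)) = cs.longest I := by
  obtain ⟨h₁, h₂⟩ := cs.eq_and_parabolic_eq_of_coset_eq (cs.rep_mem_minReps _) hx
    (cs.eq_coset_rep (cs.coset x I)).symm
  exact ⟨h₁, cs.longest_eq_of_parabolic_eq h₂⟩

/-- The longest element of `W`. -/
noncomputable def longestElement : W := cs.longest Set.univ

/-- The pullback of a relation along left multiplication by the longest element. -/
noncomputable def dualSetoid (r : Setoid W) : Setoid W :=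
  r.comap (cs.longestElement * ·)

theorem dualSetoid_apply {r : Setoid W} {x y : W} :
    cs.dualSetoid r x y ↔ r (cs.longestElement * x) (cs.longestElement * y) := Iff.rfl

end Parabolic

/-! ### Longest elements and the lattice property. -/

section Finite

variable {B W : Type*} [Group W] [Finite W] {M : CoxeterMatrix B} (cs : CoxeterSystem M W)

theorem longest_spec (I : Set B) :
    cs.longest I ∈ cs.parabolic I ∧
      ∀ v ∈ cs.parabolic I, cs.length v ≤ cs.length (cs.longest I) := by
  obtain ⟨w, hw, hmax⟩ := (Set.toFinite (cs.parabolic I : Set W)).exists_maximalFor cs.length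
    _ ⟨1, one_mem _⟩
  exact Classical.epsilon_spec (p := fun w => w ∈ cs.parabolic I ∧
    ∀ v ∈ cs.parabolic I, cs.length v ≤ cs.length w)
    ⟨w, hw, fun v hv => (le_total _ _).elim id fun h => hmax hv h⟩

theorem longest_mem (I : Set B) : cs.longest I ∈ cs.parabolic I := (cs.longest_spec I).1

theorem isLeftDescent_longest {I : Set B} {i : B} (hi : i ∈ I) :
    cs.IsLeftDescent (cs.longest I) i :=
  lt_of_le_of_ne
    ((cs.longest_spec I).2 _ (mul_mem (cs.simple_mem_parabolic hi) (cs.longest_mem I)))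
    (cs.length_simple_mul_ne _ i)

theorem weakLE_longest {I : Set B} {u : W} (hu : u ∈ cs.parabolic I) :
    cs.WeakLE u (cs.longest I) :=
  cs.weakLE_of_forall_isLeftDescent (fun _ hi => cs.isLeftDescent_longest hi) hu

theorem inv_longest (I : Set B) : (cs.longest I)⁻¹ = cs.longest I := by
  have h := cs.weakLE_longest (inv_mem (cs.longest_mem I))
  rw [WeakLE, length_inv] at h
  have : cs.length ((cs.longest I)⁻¹⁻¹ * cs.longest I) = 0 := by omega
  rwa [length_eq_zero_iff, inv_mul_eq_one] at this

@[simp]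
theorem longest_mul_longest (I : Set B) : cs.longest I * cs.longest I = 1 := by
  rw [mul_eq_one_iff_inv_eq, inv_longest]

@[simp]
theorem mul_longest_mul_longest (I : Set B) (x : W) :
    x * cs.longest I * cs.longest I = x := by
  rw [mul_assoc, longest_mul_longest, mul_one]

theorem weakLE_mul_longest {I : Set B} {x a : W} (hx : x ∈ cs.minReps I)
    (ha : a ∈ cs.parabolic I) : cs.WeakLE (x * a) (x * cs.longest I) := by
  have h := cs.weakLE_longest ha
  have e : (x * a)⁻¹ * (x * cs.longest I) = a⁻¹ * cs.longest I := by group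
  rw [WeakLE, e, cs.length_mul_of_mem_minReps hx ha,
    cs.length_mul_of_mem_minReps hx (cs.longest_mem I), add_assoc]
  rw [WeakLE] at h
  rw [h]

/-- For `x ∈ W^I`, `x * w_I` is the join of `x` and the `x * s` with `s ∈ I`. -/
theorem mul_longest_weakLE {I : Set B} {x v : W} (hx : x ∈ cs.minReps I) (hv : cs.WeakLE x v)
    (h : ∀ i ∈ I, cs.WeakLE (x * cs.simple i) v) : cs.WeakLE (x * cs.longest I) v := by
  have h₁ : cs.WeakLE (cs.longest I) (x⁻¹ * v) :=
    cs.weakLE_of_forall_isLeftDescent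
      (fun i hi => (cs.mul_simple_weakLE_iff (hx i hi) hv).mp (h i hi)) (cs.longest_mem I)
  rw [WeakLE, cs.length_mul_of_mem_minReps hx (cs.longest_mem I)]
  have e : (x * cs.longest I)⁻¹ * v = (cs.longest I)⁻¹ * (x⁻¹ * v) := by group
  rw [e, add_assoc]
  unfold WeakLE at h₁ hv
  rw [h₁, hv]

@[simp]
theorem longestElement_mul_cancel_left (x : W) :
    cs.longestElement * (cs.longestElement * x) = x := by
  rw [← mul_assoc, longestElement, longest_mul_longest, one_mul]

theorem length_longestElement_mul (x : W) :
    cs.length x + cs.length (cs.longestElement * x) = cs.length cs.longestElement := by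
  have h := cs.weakLE_longest (cs.mem_parabolic_univ x)
  have e : (x⁻¹ * cs.longest Set.univ)⁻¹ = cs.longestElement * x := by
    rw [mul_inv_rev, inv_longest, inv_inv]; rfl
  rw [WeakLE, ← cs.length_inv (x⁻¹ * _), e] at h
  exact h

/-- Left multiplication by the longest element reverses the weak order. -/
theorem longestElement_mul_weakLE_iff {u v : W} :
    cs.WeakLE (cs.longestElement * u) (cs.longestElement * v) ↔ cs.WeakLE v u := by
  have h₁ := cs.length_longestElement_mul u
  have h₂ := cs.length_longestElement_mul v
  have e : (cs.longestElement * u)⁻¹ * (cs.longestElement * v) = u⁻¹ * v := by group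
  have e' : cs.length (u⁻¹ * v) = cs.length (v⁻¹ * u) := by
    rw [← length_inv, mul_inv_rev, inv_inv]
  rw [WeakLE, WeakLE, e, e']
  omega

theorem longestElement_mul_weakLE_comm {u v : W} :
    cs.WeakLE (cs.longestElement * u) v ↔ cs.WeakLE (cs.longestElement * v) u := by
  rw [← cs.longestElement_mul_weakLE_iff, longestElement_mul_cancel_left]

theorem weakLE_longestElement_mul_comm {u v : W} :
    cs.WeakLE u (cs.longestElement * v) ↔ cs.WeakLE v (cs.longestElement * u) := by
  rw [← cs.longestElement_mul_weakLE_iff, longestElement_mul_cancel_left]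

theorem longestElement_mul_mem_minReps_iff {I : Set B} {w : W} :
    cs.longestElement * w ∈ cs.minReps I ↔ ∀ i ∈ I, cs.IsRightDescent w i := by
  refine forall₂_congr fun i _ => ?_
  have h₁ := cs.length_longestElement_mul w
  have h₂ := cs.length_longestElement_mul (w * cs.simple i)
  rw [IsRightDescent, mul_assoc]
  omega

/-- Induction on the colength of a common lower bound `z`. Choose atoms `z s_i ≤ x` and `z s_k ≤ y`;
their join `p = z w_{i,k}` lies below every common upper bound. Join `x` with `p` above `z s_i`,
then the result with `y` above `z s_k`. -/
theorem exists_weakJoin (x y : W) :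
    ∃ j, cs.WeakLE x j ∧ cs.WeakLE y j ∧ ∀ v, cs.WeakLE x v → cs.WeakLE y v → cs.WeakLE j v := by
  suffices H : ∀ (n : ℕ) (z : W), cs.length cs.longestElement - cs.length z = n →
      ∀ x y, cs.WeakLE z x → cs.WeakLE z y → ∃ j, cs.WeakLE x j ∧ cs.WeakLE y j ∧
        ∀ v, cs.WeakLE x v → cs.WeakLE y v → cs.WeakLE j v from
    H _ 1 rfl x y (by simp [WeakLE]) (by simp [WeakLE])
  intro n
  induction n using Nat.strong_induction_on with
  | _ n ih =>
    intro z hz x y hx hy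
    by_cases hzx : z = x
    · exact ⟨y, hzx ▸ hy, cs.weakLE_refl y, fun v _ h => h⟩
    by_cases hzy : z = y
    · exact ⟨x, cs.weakLE_refl x, hzy ▸ hx, fun v h _ => h⟩
    obtain ⟨i, hi, hix⟩ := cs.exists_mul_simple_weakLE hx hzx
    obtain ⟨k, hk, hky⟩ := cs.exists_mul_simple_weakLE hy hzy
    have hlen : ∀ w, cs.length z < cs.length w →
        cs.length cs.longestElement - cs.length w < n := by
      intro w hw
      have := cs.length_longestElement_mul w
      omega
    have hz' : z ∈ cs.minReps {i, k} := by
      rintro l (rfl | rfl)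
      · exact hi
      · exact hk
    have hli := cs.weakLE_mul_longest hz' (cs.simple_mem_parabolic (I := {i, k}) (i := i) (by simp))
    have hlk := cs.weakLE_mul_longest hz' (cs.simple_mem_parabolic (I := {i, k}) (i := k) (by simp))
    obtain ⟨x', hxx', hjx', hx'⟩ := ih _ (hlen _ hi) _ rfl _ _ hix hli
    obtain ⟨j, hj₁, hj₂, hj⟩ := ih _ (hlen _ hk) _ rfl _ _ (hlk.trans cs hjx') hky
    refine ⟨j, hxx'.trans cs hj₁, hj₂, fun v hxv hyv => hj v (hx' v hxv ?_) hyv⟩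
    refine cs.mul_longest_weakLE hz' (hx.trans cs hxv) ?_
    rintro l (rfl | rfl)
    · exact hix.trans cs hxv
    · exact hky.trans cs hyv

theorem exists_weakMeet (x y : W) :
    ∃ m, cs.WeakLE m x ∧ cs.WeakLE m y ∧ ∀ v, cs.WeakLE v x → cs.WeakLE v y → cs.WeakLE v m := by
  obtain ⟨j, h₁, h₂, h₃⟩ := cs.exists_weakJoin (cs.longestElement * x) (cs.longestElement * y)
  refine ⟨cs.longestElement * j, cs.longestElement_mul_weakLE_comm.mp h₁,
    cs.longestElement_mul_weakLE_comm.mp h₂, fun v hx hy => ?_⟩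
  rw [weakLE_longestElement_mul_comm]
  exact h₃ _ (cs.longestElement_mul_weakLE_iff.mpr hx) (cs.longestElement_mul_weakLE_iff.mpr hy)

/-- The weak order on a finite Coxeter group is a lattice. -/
noncomputable abbrev weakLattice : Lattice W where
  __ := cs.weakOrder
  sup x y := (cs.exists_weakJoin x y).choose
  inf x y := (cs.exists_weakMeet x y).choose
  le_sup_left x y := (cs.exists_weakJoin x y).choose_spec.1
  le_sup_right x y := (cs.exists_weakJoin x y).choose_spec.2.1
  sup_le x y z := (cs.exists_weakJoin x y).choose_spec.2.2 z
  inf_le_left x y := (cs.exists_weakMeet x y).choose_spec.1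
  inf_le_right x y := (cs.exists_weakMeet x y).choose_spec.2.1
  le_inf x y z := (cs.exists_weakMeet y z).choose_spec.2.2 x

end Finite

/-! ### Lattice congruences and the upward projection. -/

section Congruence

variable {B W : Type*} [Group W] [Finite W] {M : CoxeterMatrix B} {cs : CoxeterSystem M W}
  {r : Setoid W}

theorem IsWeakOrderCongruence.exists_join (hr : cs.IsWeakOrderCongruence r) {x y z : W}
    (hxz : r x z) (hxy : cs.WeakLE x y) :
    ∃ j, cs.WeakLE z j ∧ cs.WeakLE y j ∧ r y j := by
  let _ := cs.weakLattice
  have h : x ⊔ y = y := sup_eq_right.mpr hxy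
  have hj := hr.join hxz (r.refl y) (isLUB_pair (a := x) (b := y)) (isLUB_pair (a := z) (b := y))
  rw [h] at hj
  exact ⟨z ⊔ y, le_sup_left (a := z), le_sup_right (a := z), hj⟩

theorem IsWeakOrderCongruence.exists_meet (hr : cs.IsWeakOrderCongruence r) {x y z : W}
    (hxz : r x z) (hyx : cs.WeakLE y x) :
    ∃ m, cs.WeakLE m z ∧ cs.WeakLE m y ∧
      (∀ v, cs.WeakLE v z → cs.WeakLE v y → cs.WeakLE v m) ∧ r y m := by
  let _ := cs.weakLattice
  have h : x ⊓ y = y := inf_eq_right.mpr hyx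
  have hm := hr.meet hxz (r.refl y) (isGLB_pair (a := x) (b := y)) (isGLB_pair (a := z) (b := y))
  rw [h] at hm
  exact ⟨z ⊓ y, inf_le_left (a := z), inf_le_right (a := z), fun v h₁ h₂ => le_inf (c := v) h₁ h₂,
    hm⟩

/-- Classes are convex: meeting `x ≡ z` with `y` gives `x ≡ y`. -/
theorem IsWeakOrderCongruence.of_between (hr : cs.IsWeakOrderCongruence r) {x y z : W}
    (hxy : cs.WeakLE x y) (hyz : cs.WeakLE y z) (h : r x z) : r x y := by
  obtain ⟨m, h₁, -, h₃, h₄⟩ := hr.exists_meet (r.symm h) hyz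
  have : m = x := h₁.antisymm cs (h₃ x (cs.weakLE_refl x) hxy)
  exact r.symm (this ▸ h₄)

/-- A class is closed under joins, so its longest element absorbs all others. -/
theorem IsWeakOrderCongruence.exists_isGreatest (hr : cs.IsWeakOrderCongruence r) (x : W) :
    ∃ m, @IsGreatest W cs.weakOrder.toLE {y | r x y} m := by
  obtain ⟨m, hm, hmax⟩ := (Set.toFinite {y | r x y}).exists_maximalFor cs.length
    _ ⟨x, r.refl x⟩
  let _ := cs.weakLattice
  refine ⟨m, hm, fun y hy => ?_⟩
  have hsup : r x (m ⊔ y) := by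
    have := hr.join hm hy (isLUB_pair (a := x) (b := x)) (isLUB_pair (a := m) (b := y))
    rwa [sup_idem] at this
  have h₁ : cs.WeakLE m (m ⊔ y) := le_sup_left (a := m)
  have h₂ : m = m ⊔ y := by
    unfold WeakLE at h₁
    have h₃ := hmax hsup (by omega)
    have : cs.length (m⁻¹ * (m ⊔ y)) = 0 := by omega
    rwa [length_eq_zero_iff, inv_mul_eq_one] at this
  rw [h₂]
  exact le_sup_right (a := m)

theorem IsWeakOrderCongruence.isGreatest_projUp (hr : cs.IsWeakOrderCongruence r) (x : W) :
    @IsGreatest W cs.weakOrder.toLE {y | r x y} (cs.projUp r x) :=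
  Classical.epsilon_spec (hr.exists_isGreatest x)

theorem IsWeakOrderCongruence.rel_projUp (hr : cs.IsWeakOrderCongruence r) (x : W) :
    r x (cs.projUp r x) := (hr.isGreatest_projUp x).1

theorem IsWeakOrderCongruence.weakLE_projUp (hr : cs.IsWeakOrderCongruence r) {x y : W}
    (h : r x y) : cs.WeakLE y (cs.projUp r x) := (hr.isGreatest_projUp x).2 h

theorem IsWeakOrderCongruence.projUp_eq_iff (hr : cs.IsWeakOrderCongruence r) {x y : W} :
    cs.projUp r x = cs.projUp r y ↔ r x y := by
  refine ⟨fun h => r.trans (hr.rel_projUp x) (h ▸ r.symm (hr.rel_projUp y)), fun h => ?_⟩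
  exact (hr.weakLE_projUp (r.trans (r.symm h) (hr.rel_projUp x))).antisymm cs
    (hr.weakLE_projUp (r.trans h (hr.rel_projUp y)))

theorem IsWeakOrderCongruence.projUp_mono (hr : cs.IsWeakOrderCongruence r) {x y : W}
    (h : cs.WeakLE x y) : cs.WeakLE (cs.projUp r x) (cs.projUp r y) := by
  obtain ⟨j, h₁, -, h₃⟩ := hr.exists_join (hr.rel_projUp x) h
  exact h₁.trans cs (hr.weakLE_projUp h₃)

theorem IsWeakOrderCongruence.not_rel_mul_simple_of_projUp (hr : cs.IsWeakOrderCongruence r)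
    {x : W} {i : B}
    (hi : cs.length (cs.projUp r x) < cs.length (cs.projUp r x * cs.simple i)) :
    ¬ r x (cs.projUp r x * cs.simple i) := by
  intro h
  have := hr.weakLE_projUp h
  unfold WeakLE at this
  omega

/-- Existence of `σ↑(x, t)`. -/
theorem IsWeakOrderCongruence.exists_sigmaUp (hr : cs.IsWeakOrderCongruence r) {x : W} {i : B}
    (hi : cs.length x < cs.length (x * cs.simple i)) (hn : ¬ r x (x * cs.simple i)) :
    ∃ k, ¬ cs.IsRightDescent (cs.projUp r x) k ∧
      cs.WeakLECong r (x * cs.simple i) (cs.projUp r x * cs.simple k) := by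
  obtain ⟨j, hzj, htj, hj⟩ := hr.exists_join (hr.rel_projUp x) (cs.weakLE_mul_simple hi)
  have hne : cs.projUp r x ≠ j := by
    rintro rfl
    exact hn (r.trans (hr.rel_projUp x) (r.symm hj))
  obtain ⟨k, hk, hkj⟩ := cs.exists_mul_simple_weakLE hzj hne
  -- Here `j = π↑(x) ∨ x s_i ≡ x s_i`, so meeting with `π↑(x) s_k ≤ j` yields `m = x s_i ∧ π↑(x) s_k
  -- ≡ π↑(x) s_k`. As `x ≤ m ≤ x s_i`, and `m = x` would put `π↑(x) s_k` in the class of `x`, `m = x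
  -- s_i`.
  obtain ⟨m, hm₁, hm₂, hm, hrm⟩ := hr.exists_meet (r.symm hj) hkj
  have hxz := hr.weakLE_projUp (r.refl x)
  have hxm := hm x (cs.weakLE_mul_simple hi) (hxz.trans cs (cs.weakLE_mul_simple hk))
  refine ⟨k, not_lt.mpr hk.le, ?_⟩
  rcases cs.eq_or_eq_of_weakLE_mul_simple hi hxm hm₁ with rfl | rfl
  · exact absurd (r.symm hrm) (hr.not_rel_mul_simple_of_projUp hk)
  · exact ⟨hm₂, r.symm hrm⟩

/-- The top of the coset `Π↑(x W_I)` is above and congruent to the top of `x W_I`. -/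
theorem IsWeakOrderCongruence.weakLECong_mul_longest_sigmaUp (hr : cs.IsWeakOrderCongruence r)
    {x : W} {I : Set B} (hx : x ∈ cs.minReps I) :
    cs.WeakLECong r (x * cs.longest I) (cs.projUp r x * cs.longest (cs.sigmaUp r x I)) := by
  have hz := cs.projUp_mem_minReps_sigmaUp r x I
  have hxz := hr.weakLE_projUp (r.refl x)
  have hztop := cs.weakLE_mul_longest hz (one_mem _)
  rw [mul_one] at hztop
  have h₁ : cs.WeakLE (x * cs.longest I)
      (cs.projUp r x * cs.longest (cs.sigmaUp r x I)) := by
    refine cs.mul_longest_weakLE hx (hxz.trans cs hztop) fun i hi => ?_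
    by_cases hn : r x (x * cs.simple i)
    · exact (hr.weakLE_projUp hn).trans cs hztop
    · obtain ⟨k, hk, hle, hrk⟩ := hr.exists_sigmaUp (hx i hi) hn
      exact hle.trans cs
        (cs.weakLE_mul_longest hz (cs.simple_mem_parabolic ⟨i, hi, hn, hk, hle, hrk⟩))
  -- Each atom `π↑(x) s_k` is congruent to some `x s_i ≤ x w_I`, hence lies below `π↑(x w_I)`.
  have h₂ : cs.WeakLE (cs.projUp r x * cs.longest (cs.sigmaUp r x I))
      (cs.projUp r (x * cs.longest I)) := by
    refine cs.mul_longest_weakLE hz (hr.projUp_mono ?_) ?_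
    · simpa using cs.weakLE_mul_longest hx (one_mem _)
    · rintro k ⟨i, hi, -, -, -, hrk⟩
      exact (hr.weakLE_projUp hrk).trans cs
        (hr.projUp_mono (cs.weakLE_mul_longest hx (cs.simple_mem_parabolic hi)))
  exact ⟨h₁, hr.of_between h₁ h₂ (hr.rel_projUp _)⟩

/-- Simple reflections leading out of the class of `z` are determined by the class of the top of
the coset `z W_K`. -/
theorem IsWeakOrderCongruence.image_subset_of_rel (hr : cs.IsWeakOrderCongruence r) {z : W}
    {K K' : Set B} (hz : z ∈ cs.minReps K) (hz' : z ∈ cs.minReps K')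
    (hn : ∀ k ∈ K, ¬ r z (z * cs.simple k))
    (h : r (z * cs.longest K) (z * cs.longest K')) : cs.simple '' K ⊆ cs.simple '' K' := by
  rintro _ ⟨k, hk, rfl⟩
  obtain ⟨m, hm₁, hm₂, hm, hrm⟩ := hr.exists_meet h
    (cs.weakLE_mul_longest hz (cs.simple_mem_parabolic hk))
  have hztop := cs.weakLE_mul_longest hz' (one_mem _)
  rw [mul_one] at hztop
  have hzm := hm z hztop (cs.weakLE_mul_simple (hz k hk))
  rcases cs.eq_or_eq_of_weakLE_mul_simple (hz k hk) hzm hm₂ with rfl | rfl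
  · exact absurd (r.symm hrm) (hn k hk)
  · have hd := (cs.mul_simple_weakLE_iff (hz k hk) hztop).mp hm₁
    rw [inv_mul_cancel_left] at hd
    exact cs.simple_mem_image_of_isLeftDescent (cs.longest_mem K') hd

theorem IsWeakOrderCongruence.coset_sigmaUp_eq_iff (hr : cs.IsWeakOrderCongruence r) {x y : W}
    {I J : Set B} (hx : x ∈ cs.minReps I) (hy : y ∈ cs.minReps J) :
    cs.coset (cs.projUp r x) (cs.sigmaUp r x I) = cs.coset (cs.projUp r y) (cs.sigmaUp r y J) ↔
      r x y ∧ r (x * cs.longest I) (y * cs.longest J) := by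
  have hzx := cs.projUp_mem_minReps_sigmaUp r x I
  have hzy := cs.projUp_mem_minReps_sigmaUp r y J
  have htx := (hr.weakLECong_mul_longest_sigmaUp hx).2
  have hty := (hr.weakLECong_mul_longest_sigmaUp hy).2
  constructor
  · intro h
    obtain ⟨h₁, h₂⟩ := cs.eq_and_parabolic_eq_of_coset_eq hzx hzy h
    refine ⟨hr.projUp_eq_iff.mp h₁, r.trans htx ?_⟩
    rw [h₁, cs.longest_eq_of_parabolic_eq h₂]
    exact r.symm hty
  · rintro ⟨h₁, h₂⟩
    have h₃ := r.trans (r.symm htx) (r.trans h₂ hty)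
    have hn : ∀ (w : W) (L : Set B), ∀ k ∈ cs.sigmaUp r w L,
        ¬ r (cs.projUp r w) (cs.projUp r w * cs.simple k) := fun w L k hk h =>
      hr.not_rel_mul_simple_of_projUp (cs.projUp_mem_minReps_sigmaUp r w L k hk)
        (r.trans (hr.rel_projUp w) h)
    have hnx := hn x I
    have hny := hn y J
    rw [hr.projUp_eq_iff.mpr h₁] at h₃ hzx hnx ⊢
    exact cs.coset_eq_of_parabolic_eq _ (cs.parabolic_eq_of_image_eq
      ((hr.image_subset_of_rel hzx hzy hnx h₃).antisymm
        (hr.image_subset_of_rel hzy hzx hny (r.symm h₃))))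

/-! ### Duality and the downward projection. -/

theorem isLUB_longestElement_mul {x y m : W} (h : @IsGLB W cs.weakOrder.toLE {x, y} m) :
    @IsLUB W cs.weakOrder.toLE {cs.longestElement * x, cs.longestElement * y}
      (cs.longestElement * m) := by
  let _ := cs.weakOrder
  constructor
  · rintro _ (rfl | rfl)
    · exact cs.longestElement_mul_weakLE_iff.mpr (h.1 (by simp))
    · exact cs.longestElement_mul_weakLE_iff.mpr (h.1 (by simp))
  · intro v hv
    refine cs.longestElement_mul_weakLE_comm.mp (h.2 ?_)
    rintro _ (rfl | rfl)
    · exact cs.longestElement_mul_weakLE_comm.mp (hv (by simp))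
    · exact cs.longestElement_mul_weakLE_comm.mp (hv (by simp))

theorem isGLB_longestElement_mul {x y m : W} (h : @IsLUB W cs.weakOrder.toLE {x, y} m) :
    @IsGLB W cs.weakOrder.toLE {cs.longestElement * x, cs.longestElement * y}
      (cs.longestElement * m) := by
  let _ := cs.weakOrder
  constructor
  · rintro _ (rfl | rfl)
    · exact cs.longestElement_mul_weakLE_iff.mpr (h.1 (by simp))
    · exact cs.longestElement_mul_weakLE_iff.mpr (h.1 (by simp))
  · intro v hv
    refine cs.weakLE_longestElement_mul_comm.mp (h.2 ?_)
    rintro _ (rfl | rfl)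
    · exact cs.weakLE_longestElement_mul_comm.mp (hv (by simp))
    · exact cs.weakLE_longestElement_mul_comm.mp (hv (by simp))

theorem IsWeakOrderCongruence.dual (hr : cs.IsWeakOrderCongruence r) :
    cs.IsWeakOrderCongruence (cs.dualSetoid r) where
  meet _ _ _ _ _ _ hx hy h h' :=
    hr.join hx hy (isLUB_longestElement_mul h) (isLUB_longestElement_mul h')
  join _ _ _ _ _ _ hx hy h h' :=
    hr.meet hx hy (isGLB_longestElement_mul h) (isGLB_longestElement_mul h')

theorem IsWeakOrderCongruence.isLeast_longestElement_mul_projUp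
    (hr : cs.IsWeakOrderCongruence r) (x : W) :
    @IsLeast W cs.weakOrder.toLE {y | r x y}
      (cs.longestElement * cs.projUp (cs.dualSetoid r) (cs.longestElement * x)) := by
  constructor
  · simpa [cs.dualSetoid_apply] using hr.dual.rel_projUp (cs.longestElement * x)
  · intro y hy
    refine cs.longestElement_mul_weakLE_comm.mp (hr.dual.weakLE_projUp ?_)
    simpa [cs.dualSetoid_apply] using hy

theorem IsWeakOrderCongruence.isLeast_projDown (hr : cs.IsWeakOrderCongruence r) (x : W) :
    @IsLeast W cs.weakOrder.toLE {y | r x y} (cs.projDown r x) :=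
  Classical.epsilon_spec (p := fun m => @IsLeast W cs.weakOrder.toLE {y | r x y} m)
    ⟨_, hr.isLeast_longestElement_mul_projUp x⟩

theorem IsWeakOrderCongruence.longestElement_mul_projDown (hr : cs.IsWeakOrderCongruence r)
    (x : W) :
    cs.longestElement * cs.projDown r x =
      cs.projUp (cs.dualSetoid r) (cs.longestElement * x) := by
  let _ := cs.weakOrder
  rw [(hr.isLeast_projDown x).unique (hr.isLeast_longestElement_mul_projUp x),
    longestElement_mul_cancel_left]

theorem IsWeakOrderCongruence.projDown_eq_iff (hr : cs.IsWeakOrderCongruence r) {x y : W} :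
    cs.projDown r x = cs.projDown r y ↔ r x y := by
  rw [← mul_right_inj cs.longestElement, hr.longestElement_mul_projDown,
    hr.longestElement_mul_projDown, hr.dual.projUp_eq_iff, dualSetoid_apply]
  simp

theorem isRightDescent_mul_longest {x : W} {I : Set B} (hx : x ∈ cs.minReps I) :
    ∀ i ∈ I, cs.IsRightDescent (x * cs.longest I) i := by
  intro i hi
  have h := cs.isLeftDescent_longest hi
  rw [← cs.inv_longest, isLeftDescent_inv_iff] at h
  rw [IsRightDescent, mul_assoc, cs.length_mul_of_mem_minReps hx (cs.longest_mem I),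
    cs.length_mul_of_mem_minReps hx (mul_mem (cs.longest_mem I) (cs.simple_mem_parabolic hi))]
  exact Nat.add_lt_add_left h _

/-- The preceding lemma, transported by left multiplication by the longest element. -/
theorem mul_longest_mem_minReps {w : W} {K : Set B} (hw : ∀ k ∈ K, cs.IsRightDescent w k) :
    w * cs.longest K ∈ cs.minReps K := by
  rw [← longestElement_mul_mem_minReps_iff] at hw
  have h := isRightDescent_mul_longest hw
  rw [mul_assoc, ← longestElement_mul_mem_minReps_iff, longestElement_mul_cancel_left] at h
  exact h

/-- The defining property of `Σ↓(x, I)`. -/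
theorem IsWeakOrderCongruence.sigmaDown_spec (hr : cs.IsWeakOrderCongruence r) {x : W} {I : Set B}
    (hx : x ∈ cs.minReps I) :
    (∀ k ∈ cs.sigmaDown r x I, cs.IsRightDescent (cs.projDown r (x * cs.longest I)) k) ∧
      cs.WeakLECong r
        (cs.projDown r (x * cs.longest I) * cs.longest (cs.sigmaDown r x I)) x := by
  set m := x * cs.longest I with hm
  have hx' : cs.longestElement * m ∈ cs.minReps I :=
    cs.longestElement_mul_mem_minReps_iff.mpr (isRightDescent_mul_longest hx)
  have hd := cs.projUp_mem_minReps_sigmaUp (cs.dualSetoid r) (cs.longestElement * m) I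
  have ht := hr.dual.weakLECong_mul_longest_sigmaUp hx'
  rw [← hr.longestElement_mul_projDown] at hd ht
  -- The witness is `Σ↑` for the dual congruence at the bottom `longestElement * m` of the reversed
  -- coset.
  refine Classical.epsilon_spec (p := fun K : Set B =>
    (∀ σ ∈ K, cs.IsRightDescent (cs.projDown r m) σ) ∧
      cs.WeakLECong r (cs.projDown r m * cs.longest K) x)
    ⟨_, cs.longestElement_mul_mem_minReps_iff.mp hd, ?_⟩
  obtain ⟨h₁, h₂⟩ := ht
  rw [mul_assoc cs.longestElement, mul_assoc cs.longestElement (cs.projDown r m)] at h₁ h₂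
  rw [longestElement_mul_weakLE_iff, hm, mul_longest_mul_longest] at h₁
  rw [cs.dualSetoid_apply, longestElement_mul_cancel_left, longestElement_mul_cancel_left, hm,
    mul_longest_mul_longest] at h₂
  exact ⟨h₁, r.symm h₂⟩

/-- Used in both directions, this gives the uniqueness of `Σ↓`, up to equality of images in `W`. The
non-congruence hypothesis of `image_subset_of_rel` is automatic because `projDown` is the minimum of
its class. -/
theorem IsWeakOrderCongruence.image_subset_of_rel_projDown (hr : cs.IsWeakOrderCongruence r)
    {x : W} {K K' : Set B} (hK : ∀ k ∈ K, cs.IsRightDescent (cs.projDown r x) k)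
    (hK' : ∀ k ∈ K', cs.IsRightDescent (cs.projDown r x) k)
    (h : r (cs.projDown r x * cs.longest K) (cs.projDown r x * cs.longest K')) :
    cs.simple '' K ⊆ cs.simple '' K' := by
  rw [← longestElement_mul_mem_minReps_iff] at hK hK'
  refine hr.dual.image_subset_of_rel hK hK' (fun k hk hn => ?_) ?_
  · have hlt := hK k hk
    rw [hr.longestElement_mul_projDown] at hlt hn
    exact hr.dual.not_rel_mul_simple_of_projUp hlt
      ((cs.dualSetoid r).trans (hr.dual.rel_projUp _) hn)
  · simpa [cs.dualSetoid_apply, mul_assoc] using h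

theorem IsWeakOrderCongruence.coset_sigmaDown_eq_iff (hr : cs.IsWeakOrderCongruence r) {x y : W}
    {I J : Set B} (hx : x ∈ cs.minReps I) (hy : y ∈ cs.minReps J) :
    cs.coset (cs.projDown r (x * cs.longest I)) (cs.sigmaDown r x I) =
        cs.coset (cs.projDown r (y * cs.longest J)) (cs.sigmaDown r y J) ↔
      r x y ∧ r (x * cs.longest I) (y * cs.longest J) := by
  obtain ⟨hdx, -, hrx⟩ := hr.sigmaDown_spec hx
  obtain ⟨hdy, -, hry⟩ := hr.sigmaDown_spec hy
  constructor
  · intro h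
    -- `Π↓` presents its cosets by their top; passing to the bottom makes uniqueness of minimal
    -- representatives applicable.
    rw [← cs.coset_mul_eq _ (cs.longest_mem (cs.sigmaDown r x I)),
      ← cs.coset_mul_eq _ (cs.longest_mem (cs.sigmaDown r y J))] at h
    obtain ⟨h₁, h₂⟩ := cs.eq_and_parabolic_eq_of_coset_eq (mul_longest_mem_minReps hdx)
      (mul_longest_mem_minReps hdy) h
    refine ⟨r.trans (r.symm hrx) (h₁ ▸ hry), hr.projDown_eq_iff.mp ?_⟩
    rwa [cs.longest_eq_of_parabolic_eq h₂, mul_left_inj] at h₁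
  · rintro ⟨h₁, h₂⟩
    have h₃ := r.trans hrx (r.trans h₁ (r.symm hry))
    rw [hr.projDown_eq_iff.mpr h₂] at hdx h₃ ⊢
    exact cs.coset_eq_of_parabolic_eq _ (cs.parabolic_eq_of_image_eq
      ((hr.image_subset_of_rel_projDown hdx hdy h₃).antisymm
        (hr.image_subset_of_rel_projDown hdy hdx (r.symm h₃))))

theorem IsWeakOrderCongruence.facialCongruence_coset_iff (hr : cs.IsWeakOrderCongruence r)
    {x y : W} {I J : Set B} (hx : x ∈ cs.minReps I) (hy : y ∈ cs.minReps J) :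
    cs.facialCongruence r (cs.coset x I) (cs.coset y J) ↔
      r x y ∧ r (x * cs.longest I) (y * cs.longest J) := by
  obtain ⟨hx₁, hx₂⟩ := cs.rep_coset hx
  obtain ⟨hy₁, hy₂⟩ := cs.rep_coset hy
  refine (hr.coset_sigmaUp_eq_iff (cs.rep_mem_minReps (cs.coset x I))
    (cs.rep_mem_minReps (cs.coset y J))).trans ?_
  rw [hx₁, hx₂, hy₁, hy₂]

theorem longest_empty (cs : CoxeterSystem M W) : cs.longest ∅ = 1 := by
  simpa [parabolic] using cs.longest_mem ∅

end Congruence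

end CoxeterSystem

theorem proposition4p9 {B W : Type*} [Group W] [Finite W] {M : CoxeterMatrix B}
    (cs : CoxeterSystem M W) (r : Setoid W) (hr : cs.IsWeakOrderCongruence r) :
    (∀ F G : cs.coxeterComplex,
      cs.facialProjUp r F = cs.facialProjUp r G ↔
        cs.facialProjDown r F = cs.facialProjDown r G) ∧
    (∀ (x y : W) (I J : Set B), x ∈ cs.minReps I → y ∈ cs.minReps J →
      (cs.facialCongruence r (cs.coset x I) (cs.coset y J) ↔
        r x y ∧ r (x * cs.longest I) (y * cs.longest J))) ∧
    Setoid.comap (fun x : W => cs.coset x ∅) (cs.facialCongruence r) = r := by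
  refine ⟨fun F G => ?_, fun x y I J hx hy => hr.facialCongruence_coset_iff hx hy, ?_⟩
  · exact (hr.coset_sigmaUp_eq_iff (cs.rep_mem_minReps F) (cs.rep_mem_minReps G)).trans
      (hr.coset_sigmaDown_eq_iff (cs.rep_mem_minReps F) (cs.rep_mem_minReps G)).symm
  · ext x y
    have hempty : ∀ w : W, w ∈ cs.minReps ∅ := fun w i hi => absurd hi (Set.notMem_empty i)
    refine (hr.facialCongruence_coset_iff (hempty x) (hempty y)).trans ?_
    simp [cs.longest_empty]
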